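/- Let $\Lambda(X)$ be the ring of symmetric functions over $\mathbb{Q}$ in the variables $X=\{x_1,x_2,\ldots\}$, with power sums $p_k$, and let $\Lambda(X_1|\cdots|X_r)=\Lambda(X_1)\otimes_{\mathbb{Q}}\cdots\otimes_{\mathbb{Q}}\Lambda(X_r)$, where $X_j=\{x_{j,1},x_{j,2},\ldots\}$. For $n_1,\ldots,n_r\ge 1$ write $f(X_1^{(n_1)}|\cdots|X_r^{(n_r)})$ for the polynomial obtained from $f\in\Lambda(X_1|\cdots|X_r)$ by setting $x_{j,k}=0$ for all $j$ and all $k>n_j$, and write $f(X_1^{(n_1)}|\cdots|X_i^{(n_i)}+z|\cdots|X_r^{(n_r)})$ for the polynomial obtained by evaluating the $i$-th alphabet instead at the $n_i+1$ variables $x_{i,1},\ldots,x_{i,n_i},z$, where $z$ is a new variable. For two variables $x,y$ let $\xi_{x,y}(F)=\frac{xF(x,y)-yF(y,x)}{x-y}$, let $\xi^{(j)}_k=\xi_{x_{j,k},x_{j,k+1}}$, and let $\langle z^0\rangle$ denote the coefficient of $z^0$. For $1\le i\le r-1$ put $$D_i^{(n_1|\cdots|n_r)}(f)=\langle z^0\rangle\,\xi^{(i+1)}_{n_{i+1}-1}\cdots\xi^{(i+1)}_1\,\xi_{z,x_{i+1,1}}\Big(f(X_1^{(n_1)}|\cdots|X_i^{(n_i)}+z|\cdots|X_r^{(n_r)})\Big).$$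 Then for every $f\in\Lambda(X_1|\cdots|X_r)$ there is a unique $D_i(f)\in\Lambda(X_1|\cdots|X_r)$, the stable limit of the polynomials $D_i^{(n_1|\cdots|n_r)}(f)$, whose restriction to the variables $x_{j,k}$ with $k\le n_j$ is $D_i^{(n_1|\cdots|n_r)}(f)$ for all $n_1,\ldots,n_r\ge1$, and $$D_i(f)=\langle z^0\rangle\, f(X_1|\cdots|X_i+z^{-1}|X_{i+1}-z^{-1}|\cdots|X_r)\,\Omega(zX_{i+1}).$$ Here the right-hand side is computed in formal Laurent series in $z$ over $\Lambda(X_1|\cdots|X_r)$; $f(X_1|\cdots|X_i+z^{-1}|X_{i+1}-z^{-1}|\cdots|X_r)$ is the image of $f$ under the $\mathbb{Q}$-algebra homomorphism with $p_k(X_i)\mapsto p_k(X_i)+z^{-k}$, $p_k(X_{i+1})\mapsto p_k(X_{i+1})-z^{-k}$ and $p_k(X_j)\mapsto p_k(X_j)$ for $j\ne i,i+1$ $(k\ge 1)$; and $\Omega(zX_{i+1})=\sum_\lambda z^{|\lambda|}m_\lambda(X_{i+1})$, the sum being over all partitions $\lambda$ and $m_\lambda$ being the monomial symmetric functions. -/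

import Mathlib

noncomputable section

open scoped TensorProduct

namespace PlethysticOperators

/-! ### Symmetric functions in one alphabet -/

/-- The ring `Λ(X)` of symmetric functions over `ℚ` in the variables `x₀, x₁, …`: formal power
series of bounded degree that are fixed by every permutation of the variables. -/
def SymmFun : Subalgebra ℚ (MvPowerSeries ℕ ℚ) where
  carrier := {f | (∀ σ : Equiv.Perm ℕ, MvPowerSeries.renameEquiv ℚ σ f = f) ∧
    ∃ d : ℕ, ∀ e : ℕ →₀ ℕ, MvPowerSeries.coeff e f ≠ 0 → e.degree ≤ d}
  mul_mem' := by
    rintro f g ⟨hf, df, hdf⟩ ⟨hg, dg, hdg⟩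
    refine ⟨fun σ => by rw [map_mul, hf, hg], df + dg, fun e he => ?_⟩
    classical
    rw [MvPowerSeries.coeff_mul] at he
    obtain ⟨⟨a, b⟩, hab, h⟩ := Finset.exists_ne_zero_of_sum_ne_zero he
    rw [Finset.HasAntidiagonal.mem_antidiagonal] at hab
    have h1 := hdf a (left_ne_zero_of_mul h)
    have h2 := hdg b (right_ne_zero_of_mul h)
    dsimp only at hab
    rw [← hab, map_add]
    omega
  add_mem' := by
    rintro f g ⟨hf, df, hdf⟩ ⟨hg, dg, hdg⟩
    refine ⟨fun σ => by rw [map_add, hf, hg], df + dg, fun e he => ?_⟩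
    by_cases h : MvPowerSeries.coeff e f = 0
    · have h2 := hdg e (by simpa [h] using he)
      omega
    · have h1 := hdf e h
      omega
  algebraMap_mem' c := by
    refine ⟨fun σ => AlgEquiv.commutes _ c, 0, fun e he => ?_⟩
    classical
    rw [MvPowerSeries.algebraMap_apply, MvPowerSeries.coeff_C] at he
    have : e = 0 := by
      by_contra h
      simp [h] at he
    simp [this]

theorem renameEquiv_eq_self_iff (σ : Equiv.Perm ℕ) (f : MvPowerSeries ℕ ℚ) :
    MvPowerSeries.renameEquiv ℚ σ f = f ↔
      ∀ e : ℕ →₀ ℕ, MvPowerSeries.coeff (e.embDomain σ.toEmbedding) f =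
        MvPowerSeries.coeff e f := by
  have key : ∀ e : ℕ →₀ ℕ, MvPowerSeries.coeff (e.embDomain σ.toEmbedding)
      (MvPowerSeries.renameEquiv ℚ σ f) = MvPowerSeries.coeff e f := fun e =>
    MvPowerSeries.coeff_embDomain_rename σ.toEmbedding f e
  constructor
  · intro h e
    have := key e
    rwa [h] at this
  · intro h
    ext e
    obtain ⟨e', rfl⟩ : ∃ e', e = Finsupp.embDomain σ.toEmbedding e' := by
      refine ⟨e.embDomain σ.symm.toEmbedding, ?_⟩
      ext a
      obtain ⟨b, rfl⟩ := σ.surjective a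
      have h1 := Finsupp.embDomain_apply_self σ.toEmbedding
        (e.embDomain σ.symm.toEmbedding) b
      have h2 := Finsupp.embDomain_apply_self σ.symm.toEmbedding e (σ b)
      simp only [Equiv.coe_toEmbedding, Equiv.symm_apply_apply] at h1 h2
      rw [h1, h2]
    rw [key, h]

theorem degree_embDomain {α β : Type*} (i : α ↪ β) (e : α →₀ ℕ) :
    (e.embDomain i).degree = e.degree := by
  simp [Finsupp.degree_apply, Finsupp.support_embDomain]

theorem mem_symmFun_of_coeff {f : MvPowerSeries ℕ ℚ} (d : ℕ)
    (h : ∀ (σ : Equiv.Perm ℕ) (e : ℕ →₀ ℕ), MvPowerSeries.coeff (e.embDomain σ.toEmbedding) f =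
        MvPowerSeries.coeff e f)
    (hd : ∀ e : ℕ →₀ ℕ, MvPowerSeries.coeff e f ≠ 0 → e.degree ≤ d) : f ∈ SymmFun :=
  ⟨fun σ => (renameEquiv_eq_self_iff σ f).2 (h σ), d, hd⟩

/-- The power sum `∑ᵢ xᵢ ^ k` as a formal power series, for `k ≥ 1`. -/
def psumSeries (k : ℕ) : MvPowerSeries ℕ ℚ :=
  fun e => open Classical in if ∃ i, e = Finsupp.single i k then 1 else 0

theorem coeff_psumSeries (k : ℕ) (e : ℕ →₀ ℕ) : MvPowerSeries.coeff e (psumSeries k) =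
    open Classical in if ∃ i, e = Finsupp.single i k then 1 else 0 := rfl

theorem psumSeries_mem (k : ℕ) : psumSeries k ∈ SymmFun := by
  refine mem_symmFun_of_coeff k (fun σ e => ?_) (fun e he => ?_)
  · have : (∃ i, e.embDomain σ.toEmbedding = Finsupp.single i k) ↔
        ∃ i, e = Finsupp.single i k := by
      constructor
      · rintro ⟨i, hi⟩
        refine ⟨σ.symm i, Finsupp.embDomain_injective σ.toEmbedding ?_⟩
        rw [hi, Finsupp.embDomain_single]
        simp
      · rintro ⟨i, rfl⟩
        exact ⟨σ i, by rw [Finsupp.embDomain_single]; rfl⟩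
    rw [coeff_psumSeries, coeff_psumSeries]
    by_cases h : ∃ i, e = Finsupp.single i k
    · rw [if_pos h, if_pos (this.2 h)]
    · rw [if_neg h, if_neg (mt this.1 h)]
  · rw [coeff_psumSeries] at he
    by_cases h : ∃ i, e = Finsupp.single i k
    · obtain ⟨i, rfl⟩ := h
      simp
    · simp [h] at he

/-- The power sum `p_k = ∑ᵢ xᵢ ^ k` in `Λ(X)`, for `k ≥ 1`. -/
def psum (k : ℕ) : SymmFun := ⟨psumSeries k, psumSeries_mem k⟩

/-- The plethystic exponential `Ω(X) = ∑_λ m_λ(X)`: every monomial has coefficient one. -/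
def Omega : MvPowerSeries ℕ ℚ := fun _ => 1

theorem homogeneousComponent_mem {f : MvPowerSeries ℕ ℚ} (k : ℕ)
    (h : ∀ σ : Equiv.Perm ℕ, MvPowerSeries.renameEquiv ℚ σ f = f) :
    MvPowerSeries.homogeneousComponent k f ∈ SymmFun := by
  refine mem_symmFun_of_coeff k (fun σ e => ?_) (fun e he => ?_)
  · rw [MvPowerSeries.coeff_homogeneousComponent, MvPowerSeries.coeff_homogeneousComponent,
      degree_embDomain, (renameEquiv_eq_self_iff σ f).1 (h σ)]
  · rw [MvPowerSeries.coeff_homogeneousComponent] at he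
    by_contra h
    exact he (if_neg (by omega))

/-- The homogeneous component of degree `k` of `Ω(X)`, as a symmetric function. -/
def OmegaPart (k : ℕ) : SymmFun :=
  ⟨MvPowerSeries.homogeneousComponent k Omega,
    homogeneousComponent_mem k fun σ => (renameEquiv_eq_self_iff σ Omega).2 fun _ => rfl⟩

/-- Setting all but the first `n` variables to zero gives a polynomial. -/
theorem killCompl_mem_range (n : ℕ) (f : SymmFun) :
    MvPowerSeries.killCompl Fin.valEmbedding (f : MvPowerSeries ℕ ℚ) ∈
      (MvPolynomial.coeToMvPowerSeries.algHom (R := ℚ) (σ := Fin n) ℚ).range := by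
  obtain ⟨d, hd⟩ := f.2.2
  refine ⟨MvPowerSeries.truncTotal (d + 1)
    (MvPowerSeries.killCompl Fin.valEmbedding (f : MvPowerSeries ℕ ℚ)), ?_⟩
  ext e
  have h1 : ∀ q : MvPolynomial (Fin n) ℚ,
      (MvPolynomial.coeToMvPowerSeries.algHom (R := ℚ) (σ := Fin n) ℚ) q = (q : MvPowerSeries _ ℚ) :=
    fun q => by ext; simp
  change MvPowerSeries.coeff e ((MvPolynomial.coeToMvPowerSeries.algHom (R := ℚ) (σ := Fin n) ℚ) _)
    = _
  rw [h1, MvPolynomial.coeff_coe, MvPowerSeries.coeff_truncTotal_eq_ite]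
  split_ifs with h
  · rfl
  · rw [MvPowerSeries.coeff_killCompl]
    by_contra h2
    have := hd _ (Ne.symm h2)
    rw [degree_embDomain] at this
    omega

theorem coe_algHom_injective (n : ℕ) : Function.Injective
    (MvPolynomial.coeToMvPowerSeries.algHom (R := ℚ) (σ := Fin n) ℚ) := by
  intro a b h
  ext e
  have := congrArg (MvPowerSeries.coeff e) h
  simpa using this

/-- The restriction `f ↦ f(x₀, …, x_{n-1}, 0, 0, …)` of a symmetric function to `n` variables. -/
def restrict (n : ℕ) : SymmFun →ₐ[ℚ] MvPolynomial (Fin n) ℚ :=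
  (AlgEquiv.ofInjective _ (coe_algHom_injective n)).symm.toAlgHom.comp
    (((MvPowerSeries.killCompl Fin.valEmbedding).comp SymmFun.val).codRestrict _
      (killCompl_mem_range n))

theorem coeff_restrict (n : ℕ) (f : SymmFun) (e : Fin n →₀ ℕ) :
    (restrict n f).coeff e =
      MvPowerSeries.coeff (e.embDomain Fin.valEmbedding) (f : MvPowerSeries ℕ ℚ) := by
  rw [← MvPowerSeries.coeff_killCompl, ← MvPolynomial.coeff_coe]
  congr 1
  have h := (AlgEquiv.ofInjective _ (coe_algHom_injective n)).apply_symm_apply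
    ⟨_, killCompl_mem_range n f⟩
  have h2 := congrArg Subtype.val h
  rw [AlgEquiv.ofInjective_apply] at h2
  rw [← show _ = (MvPowerSeries.killCompl Fin.valEmbedding) (f : MvPowerSeries ℕ ℚ) from h2]
  ext
  simp
  rfl

/-- The value `f(a₁ + ⋯ + aₙ)` of a symmetric function at a finite alphabet. -/
def evalAt {A : Type*} [CommRing A] [Algebra ℚ A] {n : ℕ} (a : Fin n → A) : SymmFun →ₐ[ℚ] A :=
  (MvPolynomial.aeval a).comp (restrict n)

/-! ### Power sums are free generators, and plethystic substitution -/

theorem restrict_psum (n : ℕ) {k : ℕ} (hk : k ≠ 0) :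
    restrict n (psum k) = MvPolynomial.psum (Fin n) ℚ k := by
  classical
  ext e
  rw [coeff_restrict, psum, coeff_psumSeries, MvPolynomial.psum, MvPolynomial.coeff_sum]
  simp only [MvPolynomial.coeff_X_pow]
  by_cases h : ∃ i, e = Finsupp.single i k
  · obtain ⟨i, rfl⟩ := h
    rw [if_pos ⟨(i : ℕ), by rw [Finsupp.embDomain_single]; rfl⟩,
      Finset.sum_eq_single i (fun j _ hj => if_neg fun hh => hj
        (Finsupp.single_left_injective hk hh)) (by simp)]
    simp
  · rw [if_neg, Finset.sum_eq_zero]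
    · intro i _
      exact if_neg fun hh => h ⟨i, hh.symm⟩
    · rintro ⟨i, hi⟩
      apply h
      have hmem : i ∈ (e.embDomain Fin.valEmbedding).support := by
        rw [hi]; simp [hk]
      rw [Finsupp.support_embDomain, Finset.mem_map] at hmem
      obtain ⟨j, _, rfl⟩ := hmem
      refine ⟨j, Finsupp.embDomain_injective Fin.valEmbedding ?_⟩
      rw [hi, Finsupp.embDomain_single]

theorem esymm_mem_range (n k : ℕ) (hkn : k ≤ n) : MvPolynomial.esymm (Fin n) ℚ k ∈
    (MvPolynomial.aeval (R := ℚ) fun m : Fin n => MvPolynomial.psum (Fin n) ℚ (m + 1)).range := by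
  induction k using Nat.strong_induction_on with
  | _ k ih =>
    rcases Nat.eq_zero_or_pos k with rfl | hk
    · rw [MvPolynomial.esymm_zero]
      exact one_mem _
    · have h := MvPolynomial.mul_esymm_eq_sum (Fin n) ℚ k
      have h2 : MvPolynomial.esymm (Fin n) ℚ k =
          ((k : ℚ)⁻¹) • ((k : MvPolynomial (Fin n) ℚ) * MvPolynomial.esymm (Fin n) ℚ k) := by
        have : (k : MvPolynomial (Fin n) ℚ) = MvPolynomial.C (k : ℚ) := by simp
        rw [this, ← MvPolynomial.smul_eq_C_mul, smul_smul, inv_mul_cancel₀, one_smul]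
        exact_mod_cast hk.ne'
      rw [h2, h]
      refine Subalgebra.smul_mem _ (mul_mem (pow_mem (neg_mem (one_mem _)) _)
        (sum_mem fun a ha => ?_)) _
      rw [Finset.mem_filter, Finset.HasAntidiagonal.mem_antidiagonal] at ha
      refine mul_mem (mul_mem (pow_mem (neg_mem (one_mem _)) _) (ih _ ha.2 (by omega))) ?_
      obtain ⟨b, hb⟩ : ∃ b, a.2 = b + 1 := ⟨a.2 - 1, by omega⟩
      rw [hb]
      exact ⟨MvPolynomial.X ⟨b, by omega⟩, by simp⟩

theorem isSymmetric_mem_range (n : ℕ) {q : MvPolynomial (Fin n) ℚ} (hq : q.IsSymmetric) : q ∈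
    (MvPolynomial.aeval (R := ℚ) fun m : Fin n => MvPolynomial.psum (Fin n) ℚ (m + 1)).range := by
  obtain ⟨Q, hQ⟩ := MvPolynomial.esymmAlgHom_fin_surjective ℚ (le_refl n) ⟨q, hq⟩
  have h := MvPolynomial.esymmAlgHom_apply (σ := Fin n) (R := ℚ) Q
  rw [hQ] at h
  change q = _ at h
  rw [h]
  clear h hQ
  induction Q using MvPolynomial.induction_on with
  | C r => rw [MvPolynomial.aeval_C]; exact Subalgebra.algebraMap_mem _ _
  | add p q hp hq => rw [map_add]; exact add_mem hp hq
  | mul_X p i hp =>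
    rw [map_mul, MvPolynomial.aeval_X]
    exact mul_mem hp (esymm_mem_range n _ i.2)

theorem surjective_endomorphism_injective {A : Type*} [CommRing A] [IsNoetherianRing A]
    (φ : A →+* A) (h : Function.Surjective φ) : Function.Injective φ := by
  have hmono : Monotone fun n : ℕ => RingHom.ker (φ ^ n) := by
    refine monotone_nat_of_le_succ fun n x hx => ?_
    rw [RingHom.mem_ker] at hx ⊢
    rw [pow_succ', RingHom.mul_def, RingHom.comp_apply, hx, map_zero]
  obtain ⟨n, hn⟩ := monotone_stabilizes_iff_noetherian.2 ‹IsNoetherianRing A› ⟨_, hmono⟩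
  have hsurj : Function.Surjective (φ ^ n) := by
    clear hn
    induction n with
    | zero => exact fun x => ⟨x, rfl⟩
    | succ n ih =>
      rw [pow_succ', RingHom.mul_def, RingHom.coe_comp]
      exact h.comp ih
  rw [injective_iff_map_eq_zero]
  intro x hx
  obtain ⟨y, rfl⟩ := hsurj x
  have h1 : y ∈ RingHom.ker (φ ^ (n + 1)) := by
    rw [RingHom.mem_ker, pow_succ', RingHom.mul_def, RingHom.comp_apply, hx]
  have h2 : RingHom.ker (φ ^ n) = RingHom.ker (φ ^ (n + 1)) := hn (n + 1) (Nat.le_succ n)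
  rw [← h2] at h1
  exact h1

theorem aeval_psum_fin_injective (n : ℕ) : Function.Injective
    (MvPolynomial.aeval (R := ℚ) fun m : Fin n => MvPolynomial.psum (Fin n) ℚ (m + 1)) := by
  let F : MvPolynomial (Fin n) ℚ →ₐ[ℚ] MvPolynomial.symmetricSubalgebra (Fin n) ℚ :=
    MvPolynomial.aeval fun m => ⟨MvPolynomial.psum (Fin n) ℚ (m + 1),
      MvPolynomial.psum_isSymmetric (Fin n) ℚ _⟩
  have hF : ∀ Q, (F Q : MvPolynomial (Fin n) ℚ) = MvPolynomial.aeval (R := ℚ)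
      (fun m : Fin n => MvPolynomial.psum (Fin n) ℚ (m + 1)) Q := fun Q =>
    (Subalgebra.mvPolynomial_aeval_coe _ _ _).symm
  let E := MvPolynomial.esymmAlgEquiv (R := ℚ) (Fin n) (n := n) (by simp)
  have hs : Function.Surjective (E.symm.toAlgHom.comp F).toRingHom := by
    intro x
    obtain ⟨Q, hQ⟩ := isSymmetric_mem_range n (E x).2
    refine ⟨Q, ?_⟩
    have : F Q = E x := Subtype.ext (by rw [hF]; exact hQ)
    change E.symm (F Q) = x
    rw [this, E.symm_apply_apply]
  have hi := surjective_endomorphism_injective _ hs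
  intro a b hab
  apply hi
  change E.symm (F a) = E.symm (F b)
  congr 1
  apply Subtype.ext
  rw [hF, hF]
  exact hab

/-- The algebra map `ℚ[t₀, t₁, …] → Λ(X)` sending `t_m` to the power sum `p_{m+1}`. -/
def psumHom : MvPolynomial ℕ ℚ →ₐ[ℚ] SymmFun :=
  MvPolynomial.aeval fun m => psum (m + 1)

theorem restrict_psumHom_rename (n : ℕ) (Q : MvPolynomial (Fin n) ℚ) :
    restrict n (psumHom (MvPolynomial.rename Fin.val Q)) =
      MvPolynomial.aeval (fun m : Fin n => MvPolynomial.psum (Fin n) ℚ (m + 1)) Q := by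
  have : ((restrict n).comp psumHom).comp (MvPolynomial.rename Fin.val) =
      MvPolynomial.aeval (fun m : Fin n => MvPolynomial.psum (Fin n) ℚ (m + 1)) := by
    ext1 i
    simp [psumHom, restrict_psum]
  exact DFunLike.congr_fun this Q

theorem psumHom_injective : Function.Injective psumHom := by
  rw [injective_iff_map_eq_zero]
  intro Q hQ
  obtain ⟨n, hn⟩ : ∃ n, ∀ i ∈ Q.vars, i < n := ⟨Q.vars.sup id + 1, fun i hi =>
    Nat.lt_succ_of_le (Finset.le_sup (f := id) hi)⟩
  obtain ⟨Q', rfl⟩ := MvPolynomial.exists_rename_eq_of_vars_subset_range Q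
    (Fin.val : Fin n → ℕ) Fin.val_injective (fun i hi => ⟨⟨i, hn i hi⟩, rfl⟩)
  have h := restrict_psumHom_rename n Q'
  rw [hQ, map_zero] at h
  rw [aeval_psum_fin_injective n (h.symm.trans (map_zero _).symm), map_zero]

theorem homogeneousComponent_mul (k : ℕ) (f g : MvPowerSeries ℕ ℚ) :
    MvPowerSeries.homogeneousComponent k (f * g) =
      ∑ a ∈ Finset.HasAntidiagonal.antidiagonal k, MvPowerSeries.homogeneousComponent a.1 f *
        MvPowerSeries.homogeneousComponent a.2 g := by
  classical
  ext e
  rw [map_sum]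
  simp only [MvPowerSeries.coeff_homogeneousComponent, MvPowerSeries.coeff_mul]
  rw [Finset.sum_comm]
  have : ∀ b ∈ Finset.HasAntidiagonal.antidiagonal e, ∑ a ∈ Finset.HasAntidiagonal.antidiagonal k,
      ((if b.1.degree = a.1 then MvPowerSeries.coeff b.1 f else 0) *
        (if b.2.degree = a.2 then MvPowerSeries.coeff b.2 g else 0)) =
      if e.degree = k then MvPowerSeries.coeff b.1 f * MvPowerSeries.coeff b.2 g else 0 := by
    intro b hb
    rw [Finset.HasAntidiagonal.mem_antidiagonal] at hb
    have hdeg : e.degree = b.1.degree + b.2.degree := by rw [← hb, map_add]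
    split_ifs with h
    · rw [Finset.sum_eq_single (b.1.degree, b.2.degree)]
      · simp
      · rintro ⟨a1, a2⟩ _ hne
        by_cases h1 : b.1.degree = a1
        · by_cases h2 : b.2.degree = a2
          · exact absurd (by rw [h1, h2]) hne
          · simp [h2]
        · simp [h1]
      · intro hh
        exact absurd (Finset.HasAntidiagonal.mem_antidiagonal.2 (by dsimp only; omega)) hh
    · refine Finset.sum_eq_zero fun a ha => ?_
      rw [Finset.HasAntidiagonal.mem_antidiagonal] at ha
      by_cases h1 : b.1.degree = a.1
      · rw [if_neg (c := b.2.degree = a.2) (by omega), mul_zero]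
      · rw [if_neg h1, zero_mul]
  rw [Finset.sum_congr rfl this]
  split_ifs <;> simp

theorem homogeneousComponent_psumHom (Q : MvPolynomial ℕ ℚ) (k : ℕ) :
    ∃ Q' : MvPolynomial ℕ ℚ, (psumHom Q' : MvPowerSeries ℕ ℚ) =
      MvPowerSeries.homogeneousComponent k (psumHom Q : MvPowerSeries ℕ ℚ) := by
  classical
  induction Q using MvPolynomial.induction_on generalizing k with
  | C r =>
    by_cases h : k = 0
    · refine ⟨MvPolynomial.C r, ?_⟩
      subst h
      ext e
      rw [MvPowerSeries.coeff_homogeneousComponent]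
      split_ifs with he
      · rfl
      · have : e ≠ 0 := by rintro rfl; simp at he
        simp [psumHom, MvPowerSeries.algebraMap_apply, MvPowerSeries.coeff_C, this]
    · refine ⟨0, ?_⟩
      ext e
      rw [MvPowerSeries.coeff_homogeneousComponent]
      split_ifs with he
      · have : e ≠ 0 := by rintro rfl; simp at he; omega
        simp [psumHom, MvPowerSeries.algebraMap_apply, MvPowerSeries.coeff_C, this]
      · simp
  | add p q hp hq =>
    obtain ⟨p', hp'⟩ := hp k
    obtain ⟨q', hq'⟩ := hq k
    exact ⟨p' + q', by simp [hp', hq']⟩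
  | mul_X p i hp =>
    have hX : ∀ j, ∃ Q' : MvPolynomial ℕ ℚ, (psumHom Q' : MvPowerSeries ℕ ℚ) =
        MvPowerSeries.homogeneousComponent j (psumSeries (i + 1)) := by
      intro j
      by_cases h : j = i + 1
      · refine ⟨MvPolynomial.X i, ?_⟩
        subst h
        ext e
        rw [MvPowerSeries.coeff_homogeneousComponent, psumHom, MvPolynomial.aeval_X, psum,
          coeff_psumSeries]
        by_cases he : ∃ a, e = Finsupp.single a (i + 1)
        · obtain ⟨a, rfl⟩ := he
          simp
        · rw [if_neg he, ite_self]
      · refine ⟨0, ?_⟩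
        ext e
        rw [MvPowerSeries.coeff_homogeneousComponent, coeff_psumSeries]
        by_cases he : ∃ a, e = Finsupp.single a (i + 1)
        · obtain ⟨a, rfl⟩ := he
          simp [Ne.symm h]
        · rw [if_neg he, ite_self]
          simp
    choose p' hp' using hp
    choose X' hX' using hX
    refine ⟨∑ a ∈ Finset.HasAntidiagonal.antidiagonal k, p' a.1 * X' a.2, ?_⟩
    have h1 : (psumHom (p * MvPolynomial.X i) : MvPowerSeries ℕ ℚ) =
        (psumHom p : MvPowerSeries ℕ ℚ) * psumSeries (i + 1) := by
      rw [map_mul]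
      simp [psumHom, psum]
    rw [h1, homogeneousComponent_mul, map_sum]
    simp [hp', hX']

theorem restrict_isSymmetric (n : ℕ) (f : SymmFun) : (restrict n f).IsSymmetric := by
  intro σ
  ext e
  obtain ⟨e', rfl⟩ : ∃ e', e = Finsupp.mapDomain σ e' :=
    ⟨Finsupp.mapDomain σ.symm e, by rw [← Finsupp.mapDomain_comp]; simp⟩
  rw [MvPolynomial.coeff_rename_mapDomain σ σ.injective, coeff_restrict, coeff_restrict,
    ← (renameEquiv_eq_self_iff (σ.viaEmbedding Fin.valEmbedding) f).1 (f.2.1 _)]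
  congr 1
  simp only [Finsupp.embDomain_eq_mapDomain, ← Finsupp.mapDomain_comp]
  congr 2
  funext x
  exact Equiv.Perm.viaEmbedding_apply σ Fin.valEmbedding x

theorem exists_perm_embDomain (n : ℕ) (e : ℕ →₀ ℕ) (he : e.degree ≤ n) :
    ∃ (σ : Equiv.Perm ℕ) (e' : Fin n →₀ ℕ),
      e.embDomain σ.toEmbedding = e'.embDomain Fin.valEmbedding := by
  classical
  have hcard : e.support.card ≤ n := by
    refine le_trans ?_ he
    rw [Finsupp.degree_apply, Finset.card_eq_sum_ones]
    exact Finset.sum_le_sum fun i hi => Nat.one_le_iff_ne_zero.2 (Finsupp.mem_support_iff.1 hi)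
  let t := Finset.range e.support.card
  let E1 : {x // x ∈ e.support} ≃ {x // x ∈ t} := Finset.equivOfCardEq (by simp [t])
  have i1 : Infinite {x // ¬ x ∈ e.support} := e.support.finite_toSet.infinite_compl.to_subtype
  have i2 : Infinite {x // ¬ x ∈ t} := t.finite_toSet.infinite_compl.to_subtype
  obtain ⟨E2⟩ := nonempty_equiv_of_countable (α := {x // ¬ x ∈ e.support}) (β := {x // ¬ x ∈ t})
  let σ : Equiv.Perm ℕ := Equiv.subtypeCongr E1 E2
  have hσ : ∀ x ∈ e.support, σ x < n := by
    intro x hx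
    have h1 : σ x = E1 ⟨x, hx⟩ := by
      simp [σ, Equiv.subtypeCongr, Equiv.sumCompl_symm_apply_of_pos (p := (· ∈ e.support)) hx]
    have h2 := (E1 ⟨x, hx⟩).2
    rw [Finset.mem_range] at h2
    omega
  have hr : e.embDomain σ.toEmbedding ∈ Set.range (Finsupp.embDomain (M := ℕ)
      (Fin.valEmbedding : Fin n ↪ ℕ)) := by
    rw [Finsupp.mem_range_embDomain_iff, Finsupp.support_embDomain]
    intro y hy
    simp only [Finset.coe_map, Set.mem_image, Finset.mem_coe] at hy
    obtain ⟨x, hx, rfl⟩ := hy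
    exact ⟨⟨σ x, hσ x hx⟩, rfl⟩
  obtain ⟨e', he'⟩ := hr
  exact ⟨σ, e', he'.symm⟩

theorem psumHom_surjective : Function.Surjective psumHom := by
  intro f
  obtain ⟨d, hd⟩ := f.2.2
  obtain ⟨Q, hQ⟩ := isSymmetric_mem_range d (restrict_isSymmetric d f)
  change MvPolynomial.aeval _ Q = _ at hQ
  rw [← restrict_psumHom_rename] at hQ
  set g := psumHom (MvPolynomial.rename Fin.val Q)
  have hlow : ∀ e : ℕ →₀ ℕ, e.degree ≤ d → MvPowerSeries.coeff e (g : MvPowerSeries ℕ ℚ) =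
      MvPowerSeries.coeff e (f : MvPowerSeries ℕ ℚ) := by
    intro e he
    obtain ⟨σ, e', hσ⟩ := exists_perm_embDomain d e he
    rw [← (renameEquiv_eq_self_iff σ _).1 (f.2.1 σ), ← (renameEquiv_eq_self_iff σ _).1 (g.2.1 σ),
      hσ, ← coeff_restrict, ← coeff_restrict, hQ]
  choose Q' hQ' using homogeneousComponent_psumHom (MvPolynomial.rename Fin.val Q)
  refine ⟨∑ k ∈ Finset.range (d + 1), Q' k, ?_⟩
  apply Subtype.ext
  rw [map_sum]
  ext e
  simp only [AddSubmonoidClass.coe_finsetSum, hQ', map_sum,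
    MvPowerSeries.coeff_homogeneousComponent, Finset.sum_ite_eq, Finset.mem_range]
  split_ifs with h
  · exact hlow e (by omega)
  · by_contra h2
    have := hd e (Ne.symm h2)
    omega

/-- `Λ(X)` is the polynomial ring over `ℚ` in the power sums `p₁, p₂, …`. -/
def psumEquiv : MvPolynomial ℕ ℚ ≃ₐ[ℚ] SymmFun :=
  AlgEquiv.ofBijective psumHom ⟨psumHom_injective, psumHom_surjective⟩

/-- The plethystic substitution prescribed by the values of the power sums: the unique
`ℚ`-algebra map `Λ(X) → A` sending `p_k` to `a k` for all `k ≥ 1`. -/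
def plethysm {A : Type*} [CommRing A] [Algebra ℚ A] (a : ℕ → A) : SymmFun →ₐ[ℚ] A :=
  (MvPolynomial.aeval fun m => a (m + 1)).comp psumEquiv.symm.toAlgHom

theorem plethysm_psum {A : Type*} [CommRing A] [Algebra ℚ A] (a : ℕ → A) {k : ℕ} (hk : 1 ≤ k) :
    plethysm a (psum k) = a k := by
  obtain ⟨m, rfl⟩ : ∃ m, k = m + 1 := ⟨k - 1, by omega⟩
  have : psumEquiv.symm (psum (m + 1)) = MvPolynomial.X m := by
    rw [AlgEquiv.symm_apply_eq]
    change _ = psumHom _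
    simp [psumHom]
  change MvPolynomial.aeval _ (psumEquiv.symm _) = _
  rw [this, MvPolynomial.aeval_X]

/-! ### Multi-symmetric functions -/

/-- The ring `Λ(X₁|⋯|X_r) = Λ(X₁) ⊗ ⋯ ⊗ Λ(X_r)` of multi-symmetric functions over `ℚ`. -/
def MultiSym (r : ℕ) : Type := ⨂[ℚ] _ : Fin r, SymmFun

instance instCommRingMultiSym (r : ℕ) : CommRing (MultiSym r) :=
  inferInstanceAs (CommRing (⨂[ℚ] _ : Fin r, SymmFun))

instance instAlgebraMultiSym (r : ℕ) : Algebra ℚ (MultiSym r) :=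
  inferInstanceAs (Algebra ℚ (⨂[ℚ] _ : Fin r, SymmFun))

/-- The function `f(X_j)` of the `j`-th alphabet alone. -/
def inAlphabet {r : ℕ} (j : Fin r) : SymmFun →ₐ[ℚ] MultiSym r :=
  PiTensorProduct.singleAlgHom (R := ℚ) (A := fun _ : Fin r => SymmFun) j

/-- Substitution in every alphabet: `f₁ ⊗ ⋯ ⊗ f_r ↦ φ₁(f₁) ⋯ φ_r(f_r)`. -/
def multiSubst {r : ℕ} {A : Type*} [CommRing A] [Algebra ℚ A] (φ : Fin r → SymmFun →ₐ[ℚ] A) :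
    MultiSym r →ₐ[ℚ] A :=
  PiTensorProduct.liftAlgHom (R := ℚ) (A := fun _ : Fin r => SymmFun)
    ((MultilinearMap.mkPiAlgebra ℚ (Fin r) A).compLinearMap fun j => (φ j).toLinearMap)
    (by simp) (by intro x y; simp [Finset.prod_mul_distrib])

/-! ### Isobaric divided differences -/

theorem sub_dvd_isobaric {σ : Type*} [DecidableEq σ] (x y : σ) (F : MvPolynomial σ ℚ) :
    (MvPolynomial.X x - MvPolynomial.X y : MvPolynomial σ ℚ) ∣
      MvPolynomial.X x * F - MvPolynomial.X y * MvPolynomial.rename (Equiv.swap x y) F := by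
  set d : MvPolynomial σ ℚ := MvPolynomial.X x - MvPolynomial.X y with hd
  have hxy : Ideal.Quotient.mkₐ ℚ (Ideal.span {d}) (MvPolynomial.X x) =
      Ideal.Quotient.mkₐ ℚ (Ideal.span {d}) (MvPolynomial.X y) := by
    rw [Ideal.Quotient.mkₐ_eq_mk, Ideal.Quotient.mk_eq_mk_iff_sub_mem]
    exact Ideal.mem_span_singleton_self d
  have h : (Ideal.Quotient.mkₐ ℚ (Ideal.span {d})).comp (MvPolynomial.rename (Equiv.swap x y)) =
      Ideal.Quotient.mkₐ ℚ (Ideal.span {d}) := by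
    ext1 i
    rw [AlgHom.comp_apply, MvPolynomial.rename_X]
    by_cases h1 : i = x
    · rw [h1, Equiv.swap_apply_left, hxy]
    · by_cases h2 : i = y
      · rw [h2, Equiv.swap_apply_right, hxy]
      · rw [Equiv.swap_apply_of_ne_of_ne h1 h2]
  rw [← Ideal.mem_span_singleton, ← Ideal.Quotient.eq_zero_iff_mem,
    ← Ideal.Quotient.mkₐ_eq_mk ℚ, map_sub, map_mul, map_mul, hxy]
  have h3 := DFunLike.congr_fun h F
  rw [AlgHom.comp_apply] at h3
  rw [h3, sub_self]

/-- The isobaric divided difference operator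
`ξ_{x,y}(F) = (x F(x,y) - y F(y,x)) / (x - y)`, for distinct variables `x`, `y`. -/
def isobaric {σ : Type*} [DecidableEq σ] (x y : σ) (F : MvPolynomial σ ℚ) : MvPolynomial σ ℚ :=
  (sub_dvd_isobaric x y F).choose

theorem isobaric_spec {σ : Type*} [DecidableEq σ] (x y : σ) (F : MvPolynomial σ ℚ) :
    MvPolynomial.X x * F - MvPolynomial.X y * MvPolynomial.rename (Equiv.swap x y) F =
      (MvPolynomial.X x - MvPolynomial.X y) * isobaric x y F :=
  (sub_dvd_isobaric x y F).choose_spec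

/-- For a list of variables `y₀, y₁, …, y_m`, the composite
`ξ_{y_{m-1},y_m} ⋯ ξ_{y₁,y₂} ξ_{y₀,y₁}` (the rightmost operator acts first). -/
def isobaricChain {σ : Type*} [DecidableEq σ] :
    List σ → MvPolynomial σ ℚ → MvPolynomial σ ℚ
  | x :: y :: l, F => isobaricChain (y :: l) (isobaric x y F)
  | _, F => F

/-! ### The operators in finitely many variables and their stable limit -/

/-- The index of the next alphabet. -/
def next {r : ℕ} (i : Fin r) (hi : (i : ℕ) + 1 < r) : Fin r := ⟨i + 1, hi⟩

/-- Names `(j, k)` of the variables `x_{j,k}`, with `n j` variables in the `j`-th alphabet. -/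
abbrev Var {r : ℕ} (n : Fin r → ℕ) : Type := Σ j : Fin r, Fin (n j)

/-- The restriction `f(X₁^{(n₁)}|⋯|X_r^{(n_r)})` of a multi-symmetric function to finitely many
variables. -/
def finRestrict {r : ℕ} (n : Fin r → ℕ) : MultiSym r →ₐ[ℚ] MvPolynomial (Var n) ℚ :=
  multiSubst fun j => evalAt fun k : Fin (n j) => MvPolynomial.X (⟨j, k⟩ : Var n)

/-- The polynomial `f(X₁^{(n₁)}|⋯|X_i^{(n_i)} + z|⋯|X_r^{(n_r)})`; the variable `z` is `none`. -/
def addVar {r : ℕ} (i : Fin r) (n : Fin r → ℕ) :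
    MultiSym r →ₐ[ℚ] MvPolynomial (Option (Var n)) ℚ :=
  multiSubst fun j =>
    if j = i then
      evalAt (Fin.snoc (fun k : Fin (n j) => MvPolynomial.X (some (⟨j, k⟩ : Var n)))
        (MvPolynomial.X none) : Fin (n j + 1) → MvPolynomial (Option (Var n)) ℚ)
    else evalAt fun k : Fin (n j) => MvPolynomial.X (some (⟨j, k⟩ : Var n))

/-- The operator
`D_i^{(n₁|⋯|n_r)} f = ⟨z⁰⟩ ξ^{(i+1)}_{n_{i+1}-1} ⋯ ξ^{(i+1)}_1 ξ_{z,x_{i+1,1}} f(⋯|X_i^{(n_i)}+z|⋯)`. -/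
def finD {r : ℕ} (i : Fin r) (hi : (i : ℕ) + 1 < r) (n : Fin r → ℕ) (f : MultiSym r) :
    MvPolynomial (Var n) ℚ :=
  (MvPolynomial.optionEquivLeft ℚ (Var n)
    (isobaricChain
      (none :: List.ofFn fun k : Fin (n (next i hi)) => some (⟨next i hi, k⟩ : Var n))
      (addVar i n f))).coeff 0

/-- `g` is the stable limit of the family `F` of polynomials in finitely many variables. -/
def IsStableLimit {r : ℕ} (F : (n : Fin r → ℕ) → MvPolynomial (Var n) ℚ) (g : MultiSym r) : Prop :=
  ∀ n : Fin r → ℕ, (∀ j, 1 ≤ n j) → finRestrict n g = F n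

/-- The operator `D_i f = lim D_i^{(n₁|⋯|n_r)} f` (zero if there is no stable limit). -/
def D {r : ℕ} (i : Fin r) (hi : (i : ℕ) + 1 < r) (f : MultiSym r) : MultiSym r :=
  open Classical in
  if h : ∃ g, IsStableLimit (fun n => finD i hi n f) g then h.choose else 0

/-! ### The plethystic side -/

/-- The power `z ^ a` in the ring of formal Laurent series in `z` over `Λ(X₁|⋯|X_r)`. -/
def zPow (r : ℕ) (a : ℤ) : LaurentSeries (MultiSym r) := HahnSeries.single a 1

/-- `f(X₁|⋯|X_i + z^{-1}|X_{i+1} - z^{-1}|⋯|X_r)`: the power sums are substituted by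
`p_k(X_i) + z^{-k}`, `p_k(X_{i+1}) - z^{-k}` and `p_k(X_j)` for `j ≠ i, i + 1`. -/
def shift {r : ℕ} (i : Fin r) (hi : (i : ℕ) + 1 < r) : MultiSym r →ₐ[ℚ] LaurentSeries (MultiSym r) :=
  multiSubst fun j => plethysm fun k =>
    if j = i then HahnSeries.C (inAlphabet j (psum k)) + zPow r (-k)
    else if j = next i hi then HahnSeries.C (inAlphabet j (psum k)) - zPow r (-k)
    else HahnSeries.C (inAlphabet j (psum k))

/-- `Ω(z X_j)`: the component of degree `k` of `Ω(X_j)` is multiplied by `z ^ k`. -/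
def OmegaZ {r : ℕ} (j : Fin r) : LaurentSeries (MultiSym r) :=
  HahnSeries.ofPowerSeries ℤ (MultiSym r) (PowerSeries.mk fun k => inAlphabet j (OmegaPart k))

end PlethysticOperators

end

/-!
Let `cₐ` be the coefficient of `t ^ a` in `f(⋯|X_i + t|X_{i+1} - t|⋯)`. Writing `X_{i+1}` as
`(X_{i+1} + z) - z` gives `f(⋯|X_i + z|⋯) = ∑ₐ cₐ(⋯|X_{i+1} + z|⋯) z ^ a`, whose coefficients are
symmetric in `z, x_{i+1,1}, x_{i+1,2}, …`. The operators `ξ` are linear over such polynomials, and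
together they send `z ^ a` to the complete homogeneous polynomial `h_a(z, x_{i+1,1}, …)`. Setting
`z = 0` leaves `∑ₐ cₐ h_a(X_{i+1})`, which no longer refers to the numbers of variables and is the
coefficient of `z ^ 0` in the Laurent series.

The stable limit is unique because finitely many power sums of finite alphabets are algebraically
independent: every variable is integral over the algebra they generate, and there are as many of
them as there are variables.
-/

noncomputable section

open MvPolynomial (X rename aeval)
open Finset.HasAntidiagonal (antidiagonal)

namespace PlethysticOperators

section Homomorphisms

variable {r : ℕ} {A : Type*} [CommRing A] [Algebra ℚ A]

theorem symmFun_algHom_ext {φ ψ : SymmFun →ₐ[ℚ] A}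
    (h : ∀ k, 1 ≤ k → φ (psum k) = ψ (psum k)) : φ = ψ := by
  have hpsum : φ.comp psumHom = ψ.comp psumHom := by
    ext m
    simpa [psumHom] using h (m + 1) (by omega)
  exact (AlgHom.cancel_right psumHom_surjective).1 hpsum

theorem multiSubst_inAlphabet (φ : Fin r → SymmFun →ₐ[ℚ] A) (j : Fin r) (f : SymmFun) :
    multiSubst φ (inAlphabet j f) = φ j f := by
  have hprod : multiSubst φ (inAlphabet j f) =
      ∏ a, φ a ((Pi.mulSingle j f : Fin r → SymmFun) a) :=
    PiTensorProduct.lift.tprod _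
  rw [hprod, Finset.prod_eq_single j]
  · rw [Pi.mulSingle_eq_same]
  · intro a _ ha
    rw [Pi.mulSingle_eq_of_ne ha, map_one]
  · simp

theorem multiSym_algHom_ext {φ ψ : MultiSym r →ₐ[ℚ] A}
    (h : ∀ j k, 1 ≤ k → φ (inAlphabet j (psum k)) = ψ (inAlphabet j (psum k))) : φ = ψ :=
  PiTensorProduct.algHom_ext (R := ℚ) (A := fun _ : Fin r => SymmFun) fun j =>
    symmFun_algHom_ext (h j)

theorem evalAt_psum {n : ℕ} (a : Fin n → A) {k : ℕ} (hk : 1 ≤ k) :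
    evalAt a (psum k) = ∑ m, a m ^ k := by
  rw [evalAt, AlgHom.comp_apply, restrict_psum n (Nat.one_le_iff_ne_zero.1 hk)]
  simp [MvPolynomial.psum]

theorem finRestrict_inAlphabet_psum (n : Fin r → ℕ) (j : Fin r) {k : ℕ} (hk : 1 ≤ k) :
    finRestrict n (inAlphabet j (psum k)) =
      ∑ m, (X ⟨j, m⟩ : MvPolynomial (Var n) ℚ) ^ k := by
  rw [finRestrict, multiSubst_inAlphabet, evalAt_psum _ hk]

end Homomorphisms

section CompleteHomogeneous

variable {A : Type*} [CommSemiring A]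

/-- The complete homogeneous symmetric polynomial `h_k(a₁, …, a_m)` evaluated at a finite list,
defined by its generating function `∏ᵢ ∑_b aᵢ ^ b t ^ b`. -/
def hcomplete (l : List A) (k : ℕ) : A :=
  PowerSeries.coeff k (l.map fun a => PowerSeries.mk (a ^ ·)).prod

theorem hcomplete_cons (a : A) (l : List A) (k : ℕ) :
    hcomplete (a :: l) k = ∑ b ∈ antidiagonal k, a ^ b.1 * hcomplete l b.2 := by
  simp only [hcomplete, List.map_cons, List.prod_cons, PowerSeries.coeff_mul, PowerSeries.coeff_mk]

theorem hcomplete_singleton (a : A) (k : ℕ) : hcomplete [a] k = a ^ k := by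
  simp [hcomplete]

theorem hcomplete_zero_cons (l : List A) (k : ℕ) : hcomplete (0 :: l) k = hcomplete l k := by
  have hzero : PowerSeries.mk ((0 : A) ^ ·) = 1 := by
    ext b
    simp [PowerSeries.coeff_one, zero_pow_eq]
  rw [hcomplete, List.map_cons, List.prod_cons, hzero, one_mul, hcomplete]

theorem map_hcomplete {B : Type*} [CommSemiring B] (φ : A →+* B) (l : List A) (k : ℕ) :
    φ (hcomplete l k) = hcomplete (l.map φ) k := by
  have hgeom : ∀ a, PowerSeries.map φ (PowerSeries.mk (a ^ ·)) = PowerSeries.mk (φ a ^ ·) := by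
    intro a
    ext b
    simp
  simp only [hcomplete, ← PowerSeries.coeff_map, map_list_prod, List.map_map, Function.comp_def,
    hgeom]

end CompleteHomogeneous

theorem restrict_omegaPart (n k : ℕ) : restrict n (OmegaPart k) =
    ∑ e ∈ Finset.finsuppAntidiag Finset.univ k, MvPolynomial.monomial e 1 := by
  classical
  ext e
  have hcoeff : (restrict n (OmegaPart k)).coeff e = if e.degree = k then 1 else 0 := by
    rw [coeff_restrict, OmegaPart, MvPowerSeries.coeff_homogeneousComponent, degree_embDomain]
    rfl
  simp [hcoeff, MvPolynomial.coeff_sum, MvPolynomial.coeff_monomial, Finsupp.degree_eq_sum]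

theorem evalAt_omegaPart {A : Type*} [CommRing A] [Algebra ℚ A] {n : ℕ} (a : Fin n → A) (k : ℕ) :
    evalAt a (OmegaPart k) = hcomplete (List.ofFn a) k := by
  rw [evalAt, AlgHom.comp_apply, restrict_omegaPart, map_sum, hcomplete, List.map_ofFn,
    List.prod_ofFn, PowerSeries.coeff_prod]
  simp [MvPolynomial.aeval_monomial, Finsupp.prod_fintype]

section Isobaric

variable {σ : Type*} [DecidableEq σ]

/-- The polynomials invariant under all transpositions of the variables in `S`. -/
def SymmetricOn {R : Type*} [CommSemiring R] (S : Set σ) (s : MvPolynomial σ R) : Prop :=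
  ∀ x ∈ S, ∀ y ∈ S, rename (Equiv.swap x y) s = s

theorem SymmetricOn.mono {R : Type*} [CommSemiring R] {S T : Set σ} {s : MvPolynomial σ R}
    (hs : SymmetricOn T s) (hST : S ⊆ T) : SymmetricOn S s :=
  fun x hx y hy => hs x (hST hx) y (hST hy)

theorem symmetricOn_X_pow {R : Type*} [CommSemiring R] {S : Set σ} {x : σ} (hx : x ∉ S) (a : ℕ) :
    SymmetricOn S (X x ^ a : MvPolynomial σ R) := fun u hu v hv => by
  rw [map_pow, MvPolynomial.rename_X,
    Equiv.swap_apply_of_ne_of_ne (ne_of_mem_of_not_mem hu hx).symm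
      (ne_of_mem_of_not_mem hv hx).symm]

theorem isobaric_eq_of_mul_eq {x y : σ} (hxy : x ≠ y) {F G : MvPolynomial σ ℚ}
    (h : X x * F - X y * rename (Equiv.swap x y) F = (X x - X y) * G) : isobaric x y F = G := by
  have hne : (X x - X y : MvPolynomial σ ℚ) ≠ 0 :=
    sub_ne_zero.2 (MvPolynomial.X_injective.ne hxy)
  exact mul_left_cancel₀ hne ((isobaric_spec x y F).symm.trans h)

theorem isobaric_sum_mul {ι : Type*} {x y : σ} (hxy : x ≠ y) (t : Finset ι)
    {c : ι → MvPolynomial σ ℚ} (hc : ∀ a ∈ t, rename (Equiv.swap x y) (c a) = c a)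
    (F : ι → MvPolynomial σ ℚ) :
    isobaric x y (∑ a ∈ t, c a * F a) = ∑ a ∈ t, c a * isobaric x y (F a) := by
  refine isobaric_eq_of_mul_eq hxy ?_
  rw [map_sum, Finset.mul_sum, Finset.mul_sum, Finset.mul_sum, ← Finset.sum_sub_distrib]
  refine Finset.sum_congr rfl fun a ha => ?_
  rw [map_mul, hc a ha]
  linear_combination c a * isobaric_spec x y (F a)

theorem isobaric_X_pow {x y : σ} (hxy : x ≠ y) (a : ℕ) :
    isobaric x y (X x ^ a) = ∑ b ∈ antidiagonal a, X x ^ b.1 * X y ^ b.2 := by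
  refine isobaric_eq_of_mul_eq hxy ?_
  rw [map_pow, MvPolynomial.rename_X, Equiv.swap_apply_left,
    Finset.Nat.sum_antidiagonal_eq_sum_range_succ_mk, mul_comm (_ - _), ← pow_succ', ← pow_succ']
  exact (Commute.geom_sum₂_mul (Commute.all _ _) (a + 1)).symm

theorem isobaricChain_sum_mul {ι : Type*} {l : List σ} (hl : l.Nodup) (t : Finset ι)
    {c : ι → MvPolynomial σ ℚ} (hc : ∀ a ∈ t, SymmetricOn {x | x ∈ l} (c a))
    (F : ι → MvPolynomial σ ℚ) :
    isobaricChain l (∑ a ∈ t, c a * F a) = ∑ a ∈ t, c a * isobaricChain l (F a) := by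
  induction l generalizing F with
  | nil => rfl
  | cons x l ih =>
    obtain _ | ⟨y, l⟩ := l
    · rfl
    obtain ⟨hx, hl⟩ := List.nodup_cons.1 hl
    have hswap : ∀ a ∈ t, rename (Equiv.swap x y) (c a) = c a := fun a ha =>
      hc a ha x (by simp) y (by simp)
    rw [isobaricChain, isobaric_sum_mul (List.ne_of_not_mem_cons hx) t hswap,
      ih hl fun a ha => (hc a ha).mono fun _ => List.mem_cons_of_mem x]
    rfl

theorem isobaricChain_X_pow {x : σ} {l : List σ} (hl : (x :: l).Nodup) (a : ℕ) :
    isobaricChain (x :: l) (X x ^ a) =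
      hcomplete ((x :: l).map (X : σ → MvPolynomial σ ℚ)) a := by
  induction l generalizing x a with
  | nil => simp [isobaricChain, hcomplete_singleton]
  | cons y l ih =>
    obtain ⟨hx, hl⟩ := List.nodup_cons.1 hl
    rw [isobaricChain, isobaric_X_pow (List.ne_of_not_mem_cons hx),
      isobaricChain_sum_mul hl _ fun b _ => symmetricOn_X_pow (S := {v | v ∈ y :: l}) hx b.1,
      List.map_cons, hcomplete_cons]
    simp only [ih hl]

end Isobaric

theorem isIntegral_of_monic_of_coeff_mem {R A : Type*} [CommRing R] [CommRing A] [Algebra R A]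
    {B : Subalgebra R A} {P : Polynomial A} (hP : P.Monic) (hB : ∀ k, P.coeff k ∈ B) {x : A}
    (hx : P.IsRoot x) : IsIntegral B x := by
  have hlift : P ∈ Polynomial.lifts (algebraMap B A) :=
    (Polynomial.lifts_iff_coeff_lifts P).2 fun k => ⟨⟨_, hB k⟩, rfl⟩
  obtain ⟨Q, hQP, -, hQ⟩ := Polynomial.lifts_and_natDegree_eq_and_monic hlift hP
  exact ⟨Q, hQ, by rw [← Polynomial.eval_map, hQP, hx.eq_zero]⟩

theorem isIntegral_of_esymm_mem {R A : Type*} [CommRing R] [CommRing A] [Algebra R A]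
    {B : Subalgebra R A} {s : Multiset A} (hB : ∀ k ≤ s.card, s.esymm k ∈ B) {x : A}
    (hx : x ∈ s) : IsIntegral B x := by
  refine isIntegral_of_monic_of_coeff_mem (Polynomial.monic_multisetProd_X_sub_C s) (fun k => ?_) ?_
  · by_cases hk : k ≤ s.card
    · rw [Multiset.prod_X_sub_C_coeff s hk]
      exact mul_mem (pow_mem (neg_mem (one_mem B)) _) (hB _ (Nat.sub_le _ _))
    · nontriviality A
      rw [Polynomial.coeff_eq_zero_of_natDegree_lt]
      · exact zero_mem B
      · exact (Polynomial.natDegree_multiset_prod_X_sub_C_eq_card s).trans_lt (not_le.1 hk)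
  · rw [Polynomial.IsRoot.def, Polynomial.eval_multiset_prod]
    exact Multiset.prod_eq_zero (by simpa [sub_eq_zero] using hx)

theorem isIntegral_of_sum_pow_mem {A : Type*} [CommRing A] [Algebra ℚ A] {n : ℕ}
    {B : Subalgebra ℚ A} {a : Fin n → A} (hB : ∀ k : Fin n, ∑ m, a m ^ (k + 1 : ℕ) ∈ B)
    (m : Fin n) : IsIntegral B (a m) := by
  have hsums : (aeval a).comp (aeval fun k : Fin n => MvPolynomial.psum (Fin n) ℚ (k + 1)) =
      aeval fun k : Fin n => ∑ m, a m ^ (k + 1 : ℕ) := by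
    ext k
    simp [MvPolynomial.psum]
  have hrange : (aeval (R := ℚ) fun k : Fin n => ∑ m, a m ^ (k + 1 : ℕ)).range ≤ B := by
    rw [← Algebra.adjoin_range_eq_range_aeval]
    exact Algebra.adjoin_le (Set.range_subset_iff.2 hB)
  refine isIntegral_of_esymm_mem (s := Finset.univ.val.map a) (fun k hk => ?_)
    (Multiset.mem_map_of_mem a (Finset.mem_univ m))
  obtain ⟨Q, hQ⟩ := esymm_mem_range n k (by simpa using hk)
  rw [← MvPolynomial.aeval_esymm_eq_multiset_esymm (Fin n) ℚ, ← hQ]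
  exact hrange ⟨Q, (DFunLike.congr_fun hsums Q).symm⟩

theorem algebraicIndependent_of_isIntegral_X {σ R : Type*} [Finite σ] [CommRing R] [IsDomain R]
    {p : σ → MvPolynomial σ R}
    (hp : ∀ v, IsIntegral (Algebra.adjoin R (Set.range p)) (X v : MvPolynomial σ R)) :
    AlgebraicIndependent R p := by
  let B := Algebra.adjoin R (Set.range p)
  have hX : Algebra.adjoin R (Set.range X) ≤
      (integralClosure B (MvPolynomial σ R)).restrictScalars R :=
    Algebra.adjoin_le (Set.range_subset_iff.2 hp)
  have : Algebra.IsIntegral B (MvPolynomial σ R) :=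
    ⟨fun F => hX (MvPolynomial.adjoin_range_X (R := R) (σ := σ) ▸ Algebra.mem_top)⟩
  have : Algebra.IsAlgebraic B (MvPolynomial σ R) := Algebra.IsIntegral.isAlgebraic
  refine (Algebra.IsAlgebraic.isTranscendenceBasis_of_lift_le_trdeg_of_finite R p ?_).1
  simp [MvPolynomial.trdeg_of_isDomain]

theorem algebraicIndependent_sum_X_pow {ι : Type*} [Finite ι] (n : ι → ℕ) :
    AlgebraicIndependent ℚ fun v : Σ j, Fin (n j) =>
      ∑ m, (X ⟨v.1, m⟩ : MvPolynomial (Σ j, Fin (n j)) ℚ) ^ (v.2 + 1 : ℕ) := by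
  refine algebraicIndependent_of_isIntegral_X fun ⟨j, m⟩ => ?_
  exact isIntegral_of_sum_pow_mem (a := fun m : Fin (n j) => X (⟨j, m⟩ : Σ j, Fin (n j)))
    (fun k => Algebra.subset_adjoin (Set.mem_range_self (⟨j, k⟩ : Σ j, Fin (n j)))) m

section StableLimit

variable {r : ℕ}

/-- The algebra map from the polynomial ring in variables `t_{j,m}` to `Λ(X₁|⋯|X_r)` sending
`t_{j,m}` to the power sum `p_{m+1}(X_j)`. -/
def multiPsumHom (r : ℕ) : MvPolynomial (Σ _ : Fin r, ℕ) ℚ →ₐ[ℚ] MultiSym r :=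
  aeval fun v => inAlphabet v.1 (psum (v.2 + 1))

theorem multiPsumHom_surjective : Function.Surjective (multiPsumHom r) := by
  let ψ : MultiSym r →ₐ[ℚ] MvPolynomial (Σ _ : Fin r, ℕ) ℚ :=
    multiSubst fun j => plethysm fun k => X ⟨j, k - 1⟩
  have hψ : (multiPsumHom r).comp ψ = AlgHom.id ℚ _ := by
    refine multiSym_algHom_ext fun j k hk => ?_
    rw [AlgHom.comp_apply, multiSubst_inAlphabet, plethysm_psum _ hk]
    simp [multiPsumHom, Nat.sub_add_cancel hk]
  exact fun f => ⟨ψ f, DFunLike.congr_fun hψ f⟩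

theorem finRestrict_multiPsumHom_rename (N : ℕ) (Q : MvPolynomial (Σ _ : Fin r, Fin N) ℚ) :
    finRestrict (fun _ => N) (multiPsumHom r (rename (Sigma.map id fun _ => Fin.val) Q)) =
      aeval (fun v : Σ _ : Fin r, Fin N =>
        ∑ m, (X ⟨v.1, m⟩ : MvPolynomial (Σ _ : Fin r, Fin N) ℚ) ^ (v.2 + 1 : ℕ)) Q := by
  rw [← AlgHom.comp_apply, ← AlgHom.comp_apply]
  congr 1
  ext1 v
  simp [multiPsumHom, finRestrict_inAlphabet_psum, Sigma.map]

theorem eq_zero_of_finRestrict {g : MultiSym r}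
    (hg : ∀ n : Fin r → ℕ, (∀ j, 1 ≤ n j) → finRestrict n g = 0) : g = 0 := by
  obtain ⟨Q, rfl⟩ := multiPsumHom_surjective g
  obtain ⟨N, hN⟩ : ∃ N, ∀ v ∈ Q.vars, v.2 < N + 1 :=
    ⟨Q.vars.sup Sigma.snd, fun v hv => Nat.lt_succ_of_le (Finset.le_sup (f := Sigma.snd) hv)⟩
  obtain ⟨Q, rfl⟩ := MvPolynomial.exists_rename_eq_of_vars_subset_range Q
    (Sigma.map id (fun _ => Fin.val) : (Σ _ : Fin r, Fin (N + 1)) → Σ _ : Fin r, ℕ)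
    (Function.injective_id.sigma_map fun _ => Fin.val_injective)
    (fun v hv => ⟨⟨v.1, v.2, hN v hv⟩, rfl⟩)
  have hQ := hg (fun _ => N + 1) fun _ => Nat.succ_pos _
  rw [finRestrict_multiPsumHom_rename] at hQ
  rw [(algebraicIndependent_sum_X_pow fun _ : Fin r => N + 1).eq_zero_of_aeval_eq_zero Q hQ,
    map_zero, map_zero]

theorem IsStableLimit.unique {F : (n : Fin r → ℕ) → MvPolynomial (Var n) ℚ} {g g' : MultiSym r}
    (hg : IsStableLimit F g) (hg' : IsStableLimit F g') : g = g' :=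
  sub_eq_zero.1 <| eq_zero_of_finRestrict fun n hn => by
    rw [map_sub, hg n hn, hg' n hn, sub_self]

end StableLimit

section Transfer

variable {r : ℕ} {i j : Fin r}

/-- The expansion of `f(⋯|X_i + t|⋯|X_j - t|⋯)` in powers of a new variable `t`, for `i ≠ j`. -/
def transfer (i j : Fin r) : MultiSym r →ₐ[ℚ] Polynomial (MultiSym r) :=
  multiSubst fun a => plethysm fun k =>
    if a = i then Polynomial.C (inAlphabet a (psum k)) + Polynomial.X ^ k
    else if a = j then Polynomial.C (inAlphabet a (psum k)) - Polynomial.X ^ k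
    else Polynomial.C (inAlphabet a (psum k))

/-- The expansion of `f(⋯|X_i + t|⋯|X_j - t|⋯)` with each power `t ^ a` replaced by the
complete homogeneous symmetric function `h_a(X_j)`, the degree `a` part of `Ω(X_j)`. -/
def transferOmega (i j : Fin r) (f : MultiSym r) : MultiSym r :=
  (transfer i j f).sum fun a c => c * inAlphabet j (OmegaPart a)

theorem zPow_pow (a : ℤ) (k : ℕ) : zPow r a ^ k = zPow r (k * a) := by
  simp [zPow, HahnSeries.single_pow]

theorem shift_eq_eval₂_transfer (hi : (i : ℕ) + 1 < r) (f : MultiSym r) :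
    shift i hi f = (transfer i (next i hi) f).eval₂ HahnSeries.C (zPow r (-1)) := by
  suffices h : shift i hi = (Polynomial.eval₂AlgHom (RingHom.toRatAlgHom HahnSeries.C)
      (zPow r (-1)) fun _ => Commute.all _ _).comp (transfer i (next i hi)) from
    DFunLike.congr_fun h f
  refine multiSym_algHom_ext fun a k hk => ?_
  rw [AlgHom.comp_apply, shift, transfer, multiSubst_inAlphabet, multiSubst_inAlphabet,
    plethysm_psum _ hk, plethysm_psum _ hk, Polynomial.eval₂AlgHom_apply]
  split_ifs <;> simp [zPow_pow]

theorem coeff_zPow_neg_mul_omegaZ (j : Fin r) (a : ℕ) :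
    (zPow r (-a) * OmegaZ j).coeff 0 = inAlphabet j (OmegaPart a) := by
  have h := HahnSeries.coeff_single_mul_add (r := (1 : MultiSym r))
    (x := OmegaZ j) (a := (a : ℤ)) (b := -(a : ℤ))
  rw [add_neg_cancel, one_mul] at h
  rw [zPow, h, OmegaZ, HahnSeries.ofPowerSeries_apply_coeff, PowerSeries.coeff_mk]

theorem coeff_shift_mul_omegaZ (hi : (i : ℕ) + 1 < r) (f : MultiSym r) :
    (shift i hi f * OmegaZ (next i hi)).coeff 0 = transferOmega i (next i hi) f := by
  rw [shift_eq_eval₂_transfer, Polynomial.eval₂_eq_sum, transferOmega, Polynomial.sum,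
    Polynomial.sum, Finset.sum_mul, HahnSeries.coeff_sum]
  refine Finset.sum_congr rfl fun a _ => ?_
  rw [zPow_pow, mul_assoc, HahnSeries.C_mul_eq_smul, HahnSeries.coeff_smul, smul_eq_mul,
    mul_neg_one, coeff_zPow_neg_mul_omegaZ]

end Transfer

section FinitelyManyVariables

variable {r : ℕ} {i j : Fin r}

theorem addVar_inAlphabet_psum_self (n : Fin r → ℕ) (j : Fin r) {k : ℕ} (hk : 1 ≤ k) :
    addVar j n (inAlphabet j (psum k)) =
      ∑ v : Option (Fin (n j)), (X (v.map (Sigma.mk j)) : MvPolynomial (Option (Var n)) ℚ) ^ k := by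
  rw [addVar, multiSubst_inAlphabet, if_pos rfl, evalAt_psum _ hk, Fin.sum_univ_castSucc,
    Fintype.sum_option, add_comm]
  simp

theorem addVar_inAlphabet_psum_of_ne (hij : i ≠ j) (n : Fin r → ℕ) {k : ℕ} (hk : 1 ≤ k) :
    addVar j n (inAlphabet i (psum k)) =
      ∑ m, (X (some ⟨i, m⟩) : MvPolynomial (Option (Var n)) ℚ) ^ k := by
  rw [addVar, multiSubst_inAlphabet, if_neg hij, evalAt_psum _ hk]

theorem addVar_eq_eval₂_transfer (hij : i ≠ j) (n : Fin r → ℕ) (f : MultiSym r) :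
    addVar i n f = (transfer i j f).eval₂
      (addVar j n : MultiSym r →+* MvPolynomial (Option (Var n)) ℚ) (X none) := by
  suffices h : addVar i n = (Polynomial.eval₂AlgHom (addVar j n) (X none)
      fun _ => Commute.all _ _).comp (transfer i j) from DFunLike.congr_fun h f
  refine multiSym_algHom_ext fun a k hk => ?_
  rw [AlgHom.comp_apply, transfer, multiSubst_inAlphabet, plethysm_psum _ hk,
    Polynomial.eval₂AlgHom_apply]
  split_ifs with hi hj
  · subst hi
    simp [addVar_inAlphabet_psum_self n a hk, addVar_inAlphabet_psum_of_ne hij n hk, add_comm]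
  · subst hj
    simp [addVar_inAlphabet_psum_self n a hk, addVar_inAlphabet_psum_of_ne hij.symm n hk]
  · simp [addVar_inAlphabet_psum_of_ne hi n hk, addVar_inAlphabet_psum_of_ne hj n hk]

/-- The variables `z, x_{j,1}, x_{j,2}, …` of the `j`-th alphabet enlarged by `z`, in the order in
which the operators `ξ` act. -/
def varsWithZ (n : Fin r → ℕ) (j : Fin r) : List (Option (Var n)) :=
  none :: List.ofFn fun m => some ⟨j, m⟩

theorem nodup_varsWithZ (n : Fin r → ℕ) (j : Fin r) : (varsWithZ n j).Nodup := by
  refine List.nodup_cons.2 ⟨by simp [List.mem_ofFn], List.nodup_ofFn.2 ?_⟩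
  exact (Option.some_injective _).comp sigma_mk_injective

theorem exists_map_eq_of_mem_varsWithZ {n : Fin r → ℕ} {x : Option (Var n)}
    (hx : x ∈ varsWithZ n j) : ∃ v : Option (Fin (n j)), v.map (Sigma.mk j) = x := by
  rcases List.mem_cons.1 hx with rfl | hx
  · exact ⟨none, rfl⟩
  · obtain ⟨m, rfl⟩ := List.mem_ofFn.1 hx
    exact ⟨some m, rfl⟩

theorem symmetricOn_addVar (n : Fin r → ℕ) (j : Fin r) (f : MultiSym r) :
    SymmetricOn {x | x ∈ varsWithZ n j} (addVar j n f) := by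
  intro x hx y hy
  obtain ⟨u, rfl⟩ := exists_map_eq_of_mem_varsWithZ hx
  obtain ⟨v, rfl⟩ := exists_map_eq_of_mem_varsWithZ hy
  let ι : Option (Fin (n j)) → Option (Var n) := Option.map fun m => ⟨j, m⟩
  have hι : Function.Injective ι :=
    Option.map_injective (sigma_mk_injective (β := fun j => Fin (n j)))
  suffices h : (rename (Equiv.swap (ι u) (ι v))).comp (addVar j n) = addVar j n from
    DFunLike.congr_fun h f
  refine multiSym_algHom_ext fun i k hk => ?_
  rw [AlgHom.comp_apply]
  by_cases hij : i = j
  · subst hij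
    rw [addVar_inAlphabet_psum_self n i hk, map_sum, ← Equiv.sum_comp (Equiv.swap u v)]
    refine Finset.sum_congr rfl fun w _ => ?_
    rw [map_pow, MvPolynomial.rename_X, hι.swap_apply, Equiv.swap_apply_self]
  · rw [addVar_inAlphabet_psum_of_ne hij n hk, map_sum]
    have hne : ∀ (m : Fin (n i)) w, (some ⟨i, m⟩ : Option (Var n)) ≠ ι w := by
      rintro m (_ | w) h
      · cases h
      · exact hij (congrArg Sigma.fst (Option.some.inj h))
    refine Finset.sum_congr rfl fun m _ => ?_
    rw [map_pow, MvPolynomial.rename_X, Equiv.swap_apply_of_ne_of_ne (hne m u) (hne m v)]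

/-- The evaluation at `z = 0`, where the variable `z` is `none`. -/
def setZZero {σ R : Type*} [CommSemiring R] : MvPolynomial (Option σ) R →ₐ[R] MvPolynomial σ R :=
  aeval fun v => v.elim 0 X

theorem coeff_zero_optionEquivLeft {σ R : Type*} [CommSemiring R] (F : MvPolynomial (Option σ) R) :
    (MvPolynomial.optionEquivLeft R σ F).coeff 0 = setZZero F := by
  have h : ((Polynomial.aeval (0 : MvPolynomial σ R)).restrictScalars R).comp
      (MvPolynomial.optionEquivLeft R σ).toAlgHom = setZZero := by
    ext1 v
    cases v <;> simp [setZZero]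
  rw [← h]
  simp [Polynomial.coeff_zero_eq_aeval_zero]

theorem setZZero_addVar (j : Fin r) (n : Fin r → ℕ) (f : MultiSym r) :
    setZZero (addVar j n f) = finRestrict n f := by
  suffices h : setZZero.comp (addVar j n) = finRestrict n from DFunLike.congr_fun h f
  refine multiSym_algHom_ext fun i k hk => ?_
  rw [AlgHom.comp_apply, finRestrict_inAlphabet_psum n i hk]
  by_cases hij : i = j
  · subst hij
    simp [addVar_inAlphabet_psum_self n i hk, setZZero, Nat.one_le_iff_ne_zero.1 hk]
  · simp [addVar_inAlphabet_psum_of_ne hij n hk, setZZero]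

theorem finRestrict_inAlphabet_omegaPart (n : Fin r → ℕ) (j : Fin r) (a : ℕ) :
    finRestrict n (inAlphabet j (OmegaPart a)) =
      hcomplete (List.ofFn fun m => (X ⟨j, m⟩ : MvPolynomial (Var n) ℚ)) a := by
  rw [finRestrict, multiSubst_inAlphabet, evalAt_omegaPart]

theorem setZZero_isobaricChain_X_pow (n : Fin r → ℕ) (j : Fin r) (a : ℕ) :
    setZZero (isobaricChain (varsWithZ n j) (X none ^ a)) =
      finRestrict n (inAlphabet j (OmegaPart a)) := by
  rw [varsWithZ, isobaricChain_X_pow (nodup_varsWithZ n j), ← AlgHom.coe_toRingHom, map_hcomplete,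
    finRestrict_inAlphabet_omegaPart]
  simp [setZZero, hcomplete_zero_cons, List.map_ofFn, Function.comp_def]

theorem setZZero_isobaricChain_addVar (hij : i ≠ j) (n : Fin r → ℕ) (f : MultiSym r) :
    setZZero (isobaricChain (varsWithZ n j) (addVar i n f)) =
      finRestrict n (transferOmega i j f) := by
  rw [addVar_eq_eval₂_transfer hij, Polynomial.eval₂_eq_sum, transferOmega, Polynomial.sum,
    Polynomial.sum, map_sum]
  simp only [RingHom.coe_coe]
  rw [isobaricChain_sum_mul (nodup_varsWithZ n j) _ fun _ _ => symmetricOn_addVar n j _, map_sum]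
  refine Finset.sum_congr rfl fun a _ => ?_
  rw [map_mul, map_mul, setZZero_addVar, setZZero_isobaricChain_X_pow]

theorem next_ne (hi : (i : ℕ) + 1 < r) : next i hi ≠ i :=
  Fin.ne_of_val_ne (Nat.succ_ne_self i)

theorem isStableLimit_transferOmega (hi : (i : ℕ) + 1 < r) (f : MultiSym r) :
    IsStableLimit (fun n => finD i hi n f) (transferOmega i (next i hi) f) := fun n _ => by
  rw [← setZZero_isobaricChain_addVar (next_ne hi).symm, ← coeff_zero_optionEquivLeft, varsWithZ]
  rfl

end FinitelyManyVariables

end PlethysticOperators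

end

open PlethysticOperators in
theorem mainTheorem4 (r : ℕ) (i : Fin r) (hi : (i : ℕ) + 1 < r) (f : MultiSym r) :
    (∃! g : MultiSym r, IsStableLimit (fun n => finD i hi n f) g) ∧
      D i hi f = (shift i hi f * OmegaZ (next i hi)).coeff 0 := by
  have hlim := isStableLimit_transferOmega hi f
  have hex : ∃ g, IsStableLimit (fun n => finD i hi n f) g := ⟨_, hlim⟩
  refine ⟨⟨_, hlim, fun g hg => hg.unique hlim⟩, ?_⟩
  rw [coeff_shift_mul_omegaZ, D, dif_pos hex]
  exact hex.choose_spec.unique hlim
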